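/- For $0<\epsilon<2$ let $C$ be the unit circle $C(t)=(\sin(\epsilon t),\cos(\epsilon t),0)$, $t\in[-\pi/\epsilon,\pi/\epsilon]$, and let $C'$ be the circle $C'(s)=(0,\ \epsilon\cos s+1,\ \epsilon\sin s)$, $s\in[-\pi,\pi]$, of radius $\epsilon$ around $(0,1,0)$. For parametrised curves $C,C'$ in $\mathbb{R}^3$ write $$G(t,s)=\frac{\det\big(\dot C(t),\,\dot C'(s),\,C(t)-C'(s)\big)}{|C(t)-C'(s)|^3}$$ where $\dot C(t)$ and $\dot C'(s)$ are the derivatives, and let $$\mathrm{link}(C,C')=\frac1{4\pi}\int_C dx^i\int_{C'}dy^j\,\epsilon_{ijk}\frac{(x-y)^k}{|x-y|^3}=\frac{1}{4\pi}\int\!\!\int G(t,s)\,ds\,dt$$ be the Gauss linking integral ($\epsilon_{ijk}$ is the Levi-Civita symbol). Then: (1) For every $\epsilon\in(0,2)$ the circles $C$ and $C'$ are disjoint; for all $t,s\in\mathbb{R}$, $$G(t,s)=G_\epsilon(t,s)=\frac{\epsilon^2\big(\cos s\,(\cos(\epsilon t)-1)+\epsilon\cos(\epsilon t)\big)}{\sqrt{2+\epsilon^2-2\cos(\epsilon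 t)+4\epsilon\cos s\,\sin^2(\epsilon t/2)}^{\,3}};$$ $G_\epsilon$ is integrable on $[-\pi/\epsilon,\pi/\epsilon]\times[-\pi,\pi]$; and $\mathrm{link}(C,C')=1$. In particular the value does not depend on $\epsilon$. (2) As $\epsilon\to0^+$, $G_\epsilon(t,s)\to(1+t^2)^{-3/2}$ for all $t,s\in\mathbb{R}$, and $$\mathrm{link}(C,C')\ \longrightarrow\ \frac1{4\pi}\int_{-\infty}^{\infty}\int_{-\pi}^{\pi}\frac{1}{(1+t^2)^{3/2}}\,ds\,dt .$$ (3) The function $(t,s)\mapsto(1+t^2)^{-3/2}$ is integrable on $\mathbb{R}\times[-\pi,\pi]$, and $$\frac1{4\pi}\int_{-\infty}^{\infty}\int_{-\pi}^{\pi}\frac{1}{(1+t^2)^{3/2}}\,ds\,dt=1 .$$ -/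

import Mathlib

open MeasureTheory Filter Topology Set

noncomputable section

/-- The density of the Gauss linking integral of two parametrised curves in `ℝ³`,
`∑ i j k, ε_{ijk} γ₁'(t)^i γ₂'(s)^j (γ₁(t) - γ₂(s))^k / |γ₁(t) - γ₂(s)|³`;
the sum against the Levi-Civita symbol is the determinant of the matrix with rows
`γ₁'(t)`, `γ₂'(s)`, `γ₁(t) - γ₂(s)`. -/
def gaussLinkingDensity (γ₁ γ₂ : ℝ → EuclideanSpace ℝ (Fin 3)) (t s : ℝ) : ℝ :=
  Matrix.det (Matrix.of ![⇑(deriv γ₁ t), ⇑(deriv γ₂ s), ⇑(γ₁ t - γ₂ s)]) / ‖γ₁ t - γ₂ s‖ ^ 3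

/-- The Gauss linking integral of the curve `γ₁`, parametrised by `[a₁, b₁]`, and the curve `γ₂`,
parametrised by `[a₂, b₂]`. -/
def gaussLinkingIntegral (γ₁ : ℝ → EuclideanSpace ℝ (Fin 3)) (a₁ b₁ : ℝ)
    (γ₂ : ℝ → EuclideanSpace ℝ (Fin 3)) (a₂ b₂ : ℝ) : ℝ :=
  1 / (4 * Real.pi) * ∫ t in a₁..b₁, ∫ s in a₂..b₂, gaussLinkingDensity γ₁ γ₂ t s

/-- The unit circle `C(t) = (sin (ε t), cos (ε t), 0)`, for `t ∈ [-π/ε, π/ε]`. -/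
def hopfC (ε t : ℝ) : EuclideanSpace ℝ (Fin 3) :=
  !₂[Real.sin (ε * t), Real.cos (ε * t), 0]

/-- The circle `C'(s) = (0, ε cos s + 1, ε sin s)` of radius `ε` around `(0, 1, 0)`,
for `s ∈ [-π, π]`. -/
def hopfC' (ε s : ℝ) : EuclideanSpace ℝ (Fin 3) :=
  !₂[0, ε * Real.cos s + 1, ε * Real.sin s]

/-- The Gauss linking integral of the `ε`-parametrised Hopf link. -/
def hopfLink (ε : ℝ) : ℝ :=
  gaussLinkingIntegral (hopfC ε) (-(Real.pi / ε)) (Real.pi / ε) (hopfC' ε) (-Real.pi) Real.pi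

end

/-!
The linking number does not change with `ε` as long as the circles stay disjoint, and in the limit
`ε → 0` the Gauss integral can be computed.

Disjointness for `0 < ε < 2` is the positivity of the squared distance (`hopfDistSq_pos`). Let `u`
and `s` be the angles on the two circles, `w = C - C'` and `f = det (∂_u C, ∂_s C', w) / |w|³`.
Since `f` is, up to sign, the `du ∧ ds`-coefficient of the pullback under `(ε, u, s) ↦ w` of the
closed solid-angle form on `ℝ³ \ {0}`, it satisfies a conservation law `∂_ε f = ∂_u P + ∂_s Q` with
explicit `P`, `Q` that are `2π`-periodic in `u` and `s` (`hopfKernelDeriv_eq`). Integrating over the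
square `[-π, π]²` shows that the linking integral has derivative zero in `ε`, so that it is constant
on `(0, 2)` (`integral_hopfKernel_eq`).

In the parameter `t = u / ε` the density converges pointwise to `(1 + t²)^(-3/2)`. On the growing
domain `|t| ≤ π / ε` it is dominated by `10 / (1 + t²)` (`abs_hopfScaledDensity_le`), although one
term of its numerator grows like `ε t²`. Dominated convergence then gives the limit
`(4π)⁻¹ · 2π · ∫ (1 + t²)^(-3/2) dt = 1`, where the integral is evaluated with the primitive
`t / √(1 + t²)`.
-/

/-! ### The linking density in angular coordinates -/

/-- The squared distance between the points of the two circles at angles `u` and `s`. -/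
noncomputable def hopfDistSq (ε u s : ℝ) : ℝ :=
  ε ^ 2 + 2 * (1 - Real.cos u) * (1 + ε * Real.cos s)

/-- The linking density of the two circles when both are parametrised by their angles,
`u = ε t` on the unit circle and `s` on the circle of radius `ε`. -/
noncomputable def hopfKernel (ε u s : ℝ) : ℝ :=
  ε * (Real.cos s * (Real.cos u - 1) + ε * Real.cos u) / Real.sqrt (hopfDistSq ε u s) ^ 3

theorem hopfDistSq_pos {ε : ℝ} (h0 : 0 < ε) (h2 : ε < 2) (u s : ℝ) : 0 < hopfDistSq ε u s := by
  unfold hopfDistSq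
  have hu1 := Real.cos_le_one u
  have hu2 := Real.neg_one_le_cos u
  have hs := Real.neg_one_le_cos s
  -- Replacing `cos s` by `-1` leaves an affine function of `cos u`, with the values `ε²` at
  -- `cos u = 1` and `(2 - ε)²` at `cos u = -1`.
  have h1 : 0 ≤ (1 - Real.cos u) * (ε * (1 + Real.cos s)) :=
    mul_nonneg (by linarith) (mul_nonneg h0.le (by linarith))
  have h3 : 0 < (1 + Real.cos u) * ε ^ 2 + (1 - Real.cos u) * (2 - ε) ^ 2 := by
    rcases lt_or_ge 0 (Real.cos u) with h | h
    · exact add_pos_of_pos_of_nonneg (mul_pos (by linarith) (by positivity))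
        (mul_nonneg (by linarith) (by positivity))
    · exact add_pos_of_nonneg_of_pos (mul_nonneg (by linarith) (by positivity))
        (mul_pos (by linarith) (pow_pos (by linarith) 2))
  nlinarith

theorem norm_hopfC_sub_hopfC'_sq (ε t s : ℝ) :
    ‖hopfC ε t - hopfC' ε s‖ ^ 2 = hopfDistSq ε (ε * t) s := by
  rw [EuclideanSpace.norm_sq_eq, Fin.sum_univ_three]
  simp only [hopfC, hopfC', hopfDistSq, PiLp.sub_apply, Real.norm_eq_abs, sq_abs]
  simp
  linear_combination Real.sin_sq_add_cos_sq (ε * t) + ε ^ 2 * Real.sin_sq_add_cos_sq s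

theorem hopfC_ne_hopfC' {ε : ℝ} (h0 : 0 < ε) (h2 : ε < 2) (t s : ℝ) : hopfC ε t ≠ hopfC' ε s := by
  intro h
  have := norm_hopfC_sub_hopfC'_sq ε t s
  rw [h, sub_self, norm_zero] at this
  have := hopfDistSq_pos h0 h2 (ε * t) s
  norm_num at *
  linarith

theorem hasDerivAt_hopfC (ε t : ℝ) :
    HasDerivAt (hopfC ε) !₂[ε * Real.cos (ε * t), -(ε * Real.sin (ε * t)), 0] t := by
  have h : HasDerivAt (fun t : ℝ => ε * t) ε t := by simpa using (hasDerivAt_id t).const_mul ε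
  rw [hasDerivAt_iff_hasFDerivAt, ← hasFDerivWithinAt_univ, hasFDerivWithinAt_euclidean]
  intro i
  rw [hasFDerivWithinAt_univ]
  fin_cases i
  · exact (h.sin.congr_deriv (mul_comm _ _)).hasFDerivAt.congr_fderiv (by ext; simp)
  · exact (h.cos.congr_deriv (g' := -(ε * Real.sin (ε * t))) (by ring)).hasFDerivAt.congr_fderiv
      (by ext; simp)
  · exact (hasDerivAt_const t (0 : ℝ)).hasFDerivAt.congr_fderiv (by ext; simp)

theorem hasDerivAt_hopfC' (ε s : ℝ) :
    HasDerivAt (hopfC' ε) !₂[0, -(ε * Real.sin s), ε * Real.cos s] s := by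
  rw [hasDerivAt_iff_hasFDerivAt, ← hasFDerivWithinAt_univ, hasFDerivWithinAt_euclidean]
  intro i
  rw [hasFDerivWithinAt_univ]
  fin_cases i
  · exact (hasDerivAt_const s (0 : ℝ)).hasFDerivAt.congr_fderiv (by ext; simp)
  · exact ((((Real.hasDerivAt_cos s).const_mul ε).add_const 1).congr_deriv
      (g' := -(ε * Real.sin s)) (by ring)).hasFDerivAt.congr_fderiv (by ext; simp)
  · exact ((Real.hasDerivAt_sin s).const_mul ε).hasFDerivAt.congr_fderiv (by ext; simp)

theorem gaussLinkingDensity_hopf (ε t s : ℝ) :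
    gaussLinkingDensity (hopfC ε) (hopfC' ε) t s = ε * hopfKernel ε (ε * t) s := by
  have hn : ‖hopfC ε t - hopfC' ε s‖ = Real.sqrt (hopfDistSq ε (ε * t) s) := by
    rw [← norm_hopfC_sub_hopfC'_sq, Real.sqrt_sq (norm_nonneg _)]
  rw [gaussLinkingDensity, hn, (hasDerivAt_hopfC ε t).deriv, (hasDerivAt_hopfC' ε s).deriv,
    hopfKernel, ← mul_div_assoc, Matrix.det_fin_three]
  congr 1
  simp [hopfC, hopfC']
  linear_combination ε ^ 3 * Real.cos (ε * t) * Real.sin_sq_add_cos_sq s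
    - ε ^ 2 * Real.cos s * Real.sin_sq_add_cos_sq (ε * t)

theorem hopfDistSq_eq (ε t s : ℝ) : hopfDistSq ε (ε * t) s =
    2 + ε ^ 2 - 2 * Real.cos (ε * t) + 4 * ε * Real.cos s * Real.sin (ε * t / 2) ^ 2 := by
  rw [hopfDistSq, Real.sin_sq_eq_half_sub, mul_div_cancel₀ _ (two_ne_zero' ℝ)]
  ring

/-! ### Independence of `ε` -/

theorem HasDerivAt.div_sqrt_pow_three {f g : ℝ → ℝ} {f' g' x : ℝ} (hf : HasDerivAt f f' x)
    (hg : HasDerivAt g g' x) (hx : 0 < g x) :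
    HasDerivAt (fun y => f y / Real.sqrt (g y) ^ 3)
      ((f' * g x - 3 / 2 * f x * g') / Real.sqrt (g x) ^ 5) x := by
  have hr : 0 < Real.sqrt (g x) := Real.sqrt_pos.2 hx
  refine (hf.div ((hg.sqrt hx.ne').pow 3) (pow_pos hr 3).ne').congr_deriv ?_
  have h2 : g x = Real.sqrt (g x) ^ 2 := (Real.sq_sqrt hx.le).symm
  simp only [Pi.pow_apply]
  generalize Real.sqrt (g x) = r at *
  rw [h2]
  field_simp
  push_cast
  ring

/-- The derivative of the kernel in `ε`. -/
noncomputable def hopfKernelDeriv (ε u s : ℝ) : ℝ :=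
  ((Real.cos s * (Real.cos u - 1) + 2 * ε * Real.cos u) * hopfDistSq ε u s
    - 3 / 2 * (ε * (Real.cos s * (Real.cos u - 1) + ε * Real.cos u))
      * (2 * ε + 2 * (1 - Real.cos u) * Real.cos s)) / Real.sqrt (hopfDistSq ε u s) ^ 5

/-- The `u`-component `det (∂_ε w, ∂_s C', w) / |w|³` of the flux that transports the kernel as
`ε` varies, where `w` is the difference of the two curves. -/
noncomputable def hopfFluxU (ε u s : ℝ) : ℝ :=
  -(ε * Real.sin u) / Real.sqrt (hopfDistSq ε u s) ^ 3

/-- The derivative of `hopfFluxU` in `u`. -/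
noncomputable def hopfFluxUDeriv (ε u s : ℝ) : ℝ :=
  (-(ε * Real.cos u) * hopfDistSq ε u s
    - 3 / 2 * -(ε * Real.sin u) * (2 * Real.sin u * (1 + ε * Real.cos s)))
    / Real.sqrt (hopfDistSq ε u s) ^ 5

/-- The `s`-component `det (∂_u C, -∂_ε w, w) / |w|³` of the flux that transports the kernel as
`ε` varies, where `w` is the difference of the two curves. -/
noncomputable def hopfFluxS (ε u s : ℝ) : ℝ :=
  -(Real.sin s * (1 - Real.cos u)) / Real.sqrt (hopfDistSq ε u s) ^ 3

/-- The derivative of `hopfFluxS` in `s`. -/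
noncomputable def hopfFluxSDeriv (ε u s : ℝ) : ℝ :=
  (-(Real.cos s * (1 - Real.cos u)) * hopfDistSq ε u s
    - 3 / 2 * -(Real.sin s * (1 - Real.cos u)) * (2 * (1 - Real.cos u) * (ε * -Real.sin s)))
    / Real.sqrt (hopfDistSq ε u s) ^ 5

/-- The kernel satisfies a conservation law in `ε`, because the pullback of the solid-angle form
to the `(ε, u, s)`-space is closed. -/
theorem hopfKernelDeriv_eq (ε u s : ℝ) :
    hopfKernelDeriv ε u s = hopfFluxUDeriv ε u s + hopfFluxSDeriv ε u s := by
  rw [hopfKernelDeriv, hopfFluxUDeriv, hopfFluxSDeriv, ← add_div]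
  congr 1
  rw [hopfDistSq]
  linear_combination (-3 * ε * (1 + ε * Real.cos s)) * Real.sin_sq_add_cos_sq u
    + 3 * ε * (1 - Real.cos u) ^ 2 * Real.sin_sq_add_cos_sq s

theorem hasDerivAt_hopfKernel {ε : ℝ} (h0 : 0 < ε) (h2 : ε < 2) (u s : ℝ) :
    HasDerivAt (fun ε => hopfKernel ε u s) (hopfKernelDeriv ε u s) ε := by
  refine HasDerivAt.div_sqrt_pow_three (g := fun ε => hopfDistSq ε u s) ?_ ?_
    (hopfDistSq_pos h0 h2 u s)
  · refine ((hasDerivAt_id' ε).mul (((hasDerivAt_id' ε).mul_const (Real.cos u)).const_add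
      (Real.cos s * (Real.cos u - 1)))).congr_deriv ?_
    ring
  · refine (((hasDerivAt_id' ε).pow 2).add ((((hasDerivAt_id' ε).mul_const (Real.cos s)).const_add
      1).const_mul (2 * (1 - Real.cos u)))).congr_deriv ?_
    ring

theorem hasDerivAt_hopfFluxU {ε : ℝ} (h0 : 0 < ε) (h2 : ε < 2) (u s : ℝ) :
    HasDerivAt (fun u => hopfFluxU ε u s) (hopfFluxUDeriv ε u s) u := by
  refine HasDerivAt.div_sqrt_pow_three (g := fun u => hopfDistSq ε u s) ?_ ?_
    (hopfDistSq_pos h0 h2 u s)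
  · exact ((Real.hasDerivAt_sin u).const_mul ε).neg
  · refine (((((Real.hasDerivAt_cos u).const_sub 1).const_mul 2).mul_const
      (1 + ε * Real.cos s)).const_add (ε ^ 2)).congr_deriv ?_
    ring

theorem hasDerivAt_hopfFluxS {ε : ℝ} (h0 : 0 < ε) (h2 : ε < 2) (u s : ℝ) :
    HasDerivAt (fun s => hopfFluxS ε u s) (hopfFluxSDeriv ε u s) s := by
  refine HasDerivAt.div_sqrt_pow_three (g := fun s => hopfDistSq ε u s) ?_ ?_
    (hopfDistSq_pos h0 h2 u s)
  · exact ((Real.hasDerivAt_sin s).mul_const (1 - Real.cos u)).neg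
  · exact ((((Real.hasDerivAt_cos s).const_mul ε).const_add 1).const_mul
      (2 * (1 - Real.cos u))).const_add (ε ^ 2)

theorem continuous_hopfDistSq : Continuous fun p : ℝ × ℝ × ℝ => hopfDistSq p.1 p.2.1 p.2.2 := by
  unfold hopfDistSq
  fun_prop

theorem sqrt_hopfDistSq_pow_ne_zero {ε : ℝ} (h0 : 0 < ε) (h2 : ε < 2) (u s : ℝ) (n : ℕ) :
    Real.sqrt (hopfDistSq ε u s) ^ n ≠ 0 :=
  (pow_pos (Real.sqrt_pos.2 (hopfDistSq_pos h0 h2 u s)) n).ne'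

theorem continuous_hopfKernel {ε : ℝ} (h0 : 0 < ε) (h2 : ε < 2) :
    Continuous fun p : ℝ × ℝ => hopfKernel ε p.1 p.2 := by
  have hD : Continuous fun p : ℝ × ℝ => hopfDistSq ε p.1 p.2 := by unfold hopfDistSq; fun_prop
  exact Continuous.div (by fun_prop) (by fun_prop)
    fun p => sqrt_hopfDistSq_pow_ne_zero h0 h2 p.1 p.2 3

theorem continuous_hopfFluxUDeriv {ε : ℝ} (h0 : 0 < ε) (h2 : ε < 2) :
    Continuous fun p : ℝ × ℝ => hopfFluxUDeriv ε p.1 p.2 := by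
  have hD : Continuous fun p : ℝ × ℝ => hopfDistSq ε p.1 p.2 := by unfold hopfDistSq; fun_prop
  exact Continuous.div (by fun_prop) (by fun_prop)
    fun p => sqrt_hopfDistSq_pow_ne_zero h0 h2 p.1 p.2 5

theorem continuous_hopfFluxSDeriv {ε : ℝ} (h0 : 0 < ε) (h2 : ε < 2) :
    Continuous fun p : ℝ × ℝ => hopfFluxSDeriv ε p.1 p.2 := by
  have hD : Continuous fun p : ℝ × ℝ => hopfDistSq ε p.1 p.2 := by unfold hopfDistSq; fun_prop
  exact Continuous.div (by fun_prop) (by fun_prop)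
    fun p => sqrt_hopfDistSq_pow_ne_zero h0 h2 p.1 p.2 5

theorem continuousOn_hopfKernelDeriv :
    ContinuousOn (fun p : ℝ × ℝ × ℝ => hopfKernelDeriv p.1 p.2.1 p.2.2) (Ioo 0 2 ×ˢ univ) := by
  have hD := continuous_hopfDistSq
  exact ContinuousOn.div (by fun_prop) (by fun_prop)
    fun p hp => sqrt_hopfDistSq_pow_ne_zero hp.1.1 hp.1.2 p.2.1 p.2.2 5

/-- The total flux through the boundary of the square vanishes, since the flux is `2π`-periodic. -/
theorem integral_hopfKernelDeriv {ε : ℝ} (h0 : 0 < ε) (h2 : ε < 2) :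
    ∫ p in Icc (-Real.pi) Real.pi ×ˢ Icc (-Real.pi) Real.pi, hopfKernelDeriv ε p.1 p.2 = 0 := by
  have hU := continuous_hopfFluxUDeriv h0 h2
  have hS := continuous_hopfFluxSDeriv h0 h2
  have hK : IsCompact (Icc (-Real.pi) Real.pi ×ˢ Icc (-Real.pi) Real.pi) :=
    isCompact_Icc.prod isCompact_Icc
  have hpi : -Real.pi ≤ Real.pi := by linarith [Real.pi_pos]
  have iU : ∀ s, ∫ u in (-Real.pi)..Real.pi, hopfFluxUDeriv ε u s = 0 := fun s => by
    rw [intervalIntegral.integral_eq_sub_of_hasDerivAt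
      (fun u _ => hasDerivAt_hopfFluxU h0 h2 u s)
      ((hU.comp (by fun_prop : Continuous fun u : ℝ => (u, s))).intervalIntegrable _ _)]
    simp [hopfFluxU]
  have iS : ∀ u, ∫ s in (-Real.pi)..Real.pi, hopfFluxSDeriv ε u s = 0 := fun u => by
    rw [intervalIntegral.integral_eq_sub_of_hasDerivAt
      (fun s _ => hasDerivAt_hopfFluxS h0 h2 u s)
      ((hS.comp (by fun_prop : Continuous fun s : ℝ => (u, s))).intervalIntegrable _ _)]
    simp [hopfFluxS]
  simp only [intervalIntegral.integral_of_le hpi, ← integral_Icc_eq_integral_Ioc] at iU iS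
  have jU := hU.continuousOn.integrableOn_compact (μ := volume) hK
  have jS := hS.continuousOn.integrableOn_compact (μ := volume) hK
  simp only [hopfKernelDeriv_eq]
  rw [integral_add jU jS]
  rw [IntegrableOn, Measure.volume_eq_prod, ← Measure.prod_restrict] at jU jS
  rw [Measure.volume_eq_prod, ← Measure.prod_restrict, integral_prod_symm _ jU, integral_prod _ jS]
  simp [iU, iS]

theorem hasDerivAt_integral_hopfKernel {ε : ℝ} (h0 : 0 < ε) (h2 : ε < 2) :
    HasDerivAt (fun ε => ∫ p in Icc (-Real.pi) Real.pi ×ˢ Icc (-Real.pi) Real.pi,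
      hopfKernel ε p.1 p.2) 0 ε := by
  have hK : IsCompact (Icc (-Real.pi) Real.pi ×ˢ Icc (-Real.pi) Real.pi) :=
    isCompact_Icc.prod isCompact_Icc
  have hm : MeasurableSet (Icc (-Real.pi) Real.pi ×ˢ Icc (-Real.pi) Real.pi) :=
    measurableSet_Icc.prod measurableSet_Icc
  -- A compact neighbourhood of `ε` on which the derivative is uniformly bounded.
  have hI : Icc (ε / 2) ((ε + 2) / 2) ⊆ Ioo 0 2 := fun x hx =>
    ⟨by linarith [hx.1], by linarith [hx.2]⟩
  obtain ⟨B, hB⟩ := (isCompact_Icc.prod hK).exists_bound_of_continuousOn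
    (continuousOn_hopfKernelDeriv.mono (prod_mono hI (subset_univ _)))
  have key := hasDerivAt_integral_of_dominated_loc_of_deriv_le
    (μ := volume.restrict (Icc (-Real.pi) Real.pi ×ˢ Icc (-Real.pi) Real.pi))
    (F := fun ε (p : ℝ × ℝ) => hopfKernel ε p.1 p.2)
    (F' := fun ε (p : ℝ × ℝ) => hopfKernelDeriv ε p.1 p.2) (bound := fun _ => B)
    (s := Icc (ε / 2) ((ε + 2) / 2)) (x₀ := ε)
    (Icc_mem_nhds (by linarith) (by linarith))
    (by
      filter_upwards [Ioo_mem_nhds h0 h2] with x hx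
      exact (continuous_hopfKernel hx.1 hx.2).aestronglyMeasurable)
    ((continuous_hopfKernel h0 h2).continuousOn.integrableOn_compact hK)
    (by
      simp only [hopfKernelDeriv_eq]
      exact ((continuous_hopfFluxUDeriv h0 h2).add
        (continuous_hopfFluxSDeriv h0 h2)).aestronglyMeasurable)
    ((ae_restrict_mem hm).mono fun p hp x hx => hB (x, p) ⟨hx, hp⟩)
    (integrableOn_const hK.measure_lt_top.ne)
    (Eventually.of_forall fun p x hx => hasDerivAt_hopfKernel (hI hx).1 (hI hx).2 _ _)
  rw [integral_hopfKernelDeriv h0 h2] at key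
  exact key.2

theorem integral_hopfKernel_eq {ε δ : ℝ} (hε : ε ∈ Ioo (0 : ℝ) 2) (hδ : δ ∈ Ioo (0 : ℝ) 2) :
    ∫ p in Icc (-Real.pi) Real.pi ×ˢ Icc (-Real.pi) Real.pi, hopfKernel ε p.1 p.2 =
      ∫ p in Icc (-Real.pi) Real.pi ×ˢ Icc (-Real.pi) Real.pi, hopfKernel δ p.1 p.2 :=
  isOpen_Ioo.is_const_of_deriv_eq_zero isPreconnected_Ioo
    (fun _ hx => (hasDerivAt_integral_hopfKernel hx.1 hx.2).differentiableAt.differentiableWithinAt)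
    (fun _ hx => (hasDerivAt_integral_hopfKernel hx.1 hx.2).deriv) hε hδ

/-! ### The limit profile -/

theorem integrable_one_add_sq_rpow :
    Integrable fun t : ℝ => (1 + t ^ 2) ^ (-(3 / 2) : ℝ) := by
  have h := integrable_rpow_neg_one_add_norm_sq (E := ℝ) (μ := volume) (r := 3) (by norm_num)
  simpa [neg_div] using h

theorem one_add_sq_rpow_eq (t : ℝ) :
    (1 + t ^ 2) ^ (-(3 / 2) : ℝ) = 1 / Real.sqrt (1 + t ^ 2) ^ 3 := by
  have h : 0 < 1 + t ^ 2 := by positivity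
  rw [Real.rpow_neg h.le, Real.sqrt_eq_rpow, ← Real.rpow_mul_natCast h.le]
  norm_num

theorem tendsto_div_sqrt_one_add_sq_atTop :
    Tendsto (fun t : ℝ => t / Real.sqrt (1 + t ^ 2)) atTop (𝓝 1) := by
  have h1 : Tendsto (fun t : ℝ => 1 / Real.sqrt ((t ^ 2)⁻¹ + 1)) atTop (𝓝 1) := by
    have h : Tendsto (fun t : ℝ => (t ^ 2)⁻¹) atTop (𝓝 0) :=
      (tendsto_pow_atTop two_ne_zero).inv_tendsto_atTop
    simpa using (h.add_const 1).sqrt.inv₀ (by simp)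
  refine h1.congr' ?_
  filter_upwards [eventually_gt_atTop 0] with t ht
  have h : 1 + t ^ 2 = t ^ 2 * ((t ^ 2)⁻¹ + 1) := by field_simp
  rw [h, Real.sqrt_mul (by positivity), Real.sqrt_sq ht.le, div_mul_eq_div_div, div_self ht.ne']

theorem integral_one_add_sq_rpow : ∫ t : ℝ, (1 + t ^ 2) ^ (-(3 / 2) : ℝ) = 2 := by
  have hd : ∀ t : ℝ, HasDerivAt (fun t : ℝ => t / Real.sqrt (1 + t ^ 2))
      ((1 + t ^ 2) ^ (-(3 / 2) : ℝ)) t := fun t => by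
    have h : 0 < 1 + t ^ 2 := by positivity
    have hr := Real.sqrt_pos.2 h
    refine ((hasDerivAt_id' t).div ((((hasDerivAt_id' t).pow 2).const_add 1).sqrt h.ne')
      hr.ne').congr_deriv ?_
    rw [one_add_sq_rpow_eq]
    have h2 := Real.sq_sqrt h.le
    simp only [Pi.pow_apply]
    field_simp
    push_cast
    linear_combination 2 * h2
  have hb : Tendsto (fun t : ℝ => t / Real.sqrt (1 + t ^ 2)) atBot (𝓝 (-1)) := by
    refine (tendsto_div_sqrt_one_add_sq_atTop.comp tendsto_neg_atBot_atTop).neg.congr fun t => ?_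
    simp [neg_div]
  rw [integral_of_hasDerivAt_of_tendsto hd integrable_one_add_sq_rpow hb
    tendsto_div_sqrt_one_add_sq_atTop]
  norm_num

theorem integral_integral_one_add_sq_rpow :
    (∫ t : ℝ, ∫ _s in (-Real.pi)..Real.pi, (1 + t ^ 2) ^ (-(3 / 2) : ℝ)) = 4 * Real.pi := by
  simp only [intervalIntegral.integral_const, smul_eq_mul]
  rw [integral_const_mul, integral_one_add_sq_rpow]
  ring

theorem integrableOn_one_add_sq_rpow :
    IntegrableOn (fun p : ℝ × ℝ => (1 + p.1 ^ 2) ^ (-(3 / 2) : ℝ))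
      (univ ×ˢ Icc (-Real.pi) Real.pi) := by
  rw [IntegrableOn, Measure.volume_eq_prod, ← Measure.prod_restrict, Measure.restrict_univ]
  exact integrable_one_add_sq_rpow.comp_fst _

/-! ### The limit `ε → 0` -/

/-- The linking density in the parameters `t`, `s`, with the powers of `ε` cancelled so that it
is continuous at `ε = 0`; here `2 (1 - cos (ε t)) = ε² (t sinc (ε t / 2))²`. -/
noncomputable def hopfScaledDensity (ε t s : ℝ) : ℝ :=
  (Real.cos s * (-(ε / 2) * (t * Real.sinc (ε * t / 2)) ^ 2) + Real.cos (ε * t)) /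
    Real.sqrt (1 + (t * Real.sinc (ε * t / 2)) ^ 2 * (1 + ε * Real.cos s)) ^ 3

theorem mul_mul_sinc (ε t : ℝ) :
    ε * (t * Real.sinc (ε * t / 2)) = 2 * Real.sin (ε * t / 2) := by
  by_cases h : ε * t / 2 = 0
  · have : ε * t = 0 := by linarith
    rw [h, ← mul_assoc, this]
    simp
  · rw [Real.sinc_of_ne_zero h]
    generalize hx : ε * t / 2 = x at *
    have : ε * t = 2 * x := by linarith
    rw [← mul_assoc, this]
    field_simp

theorem mul_hopfKernel_eq {ε : ℝ} (h0 : 0 < ε) (t s : ℝ) :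
    ε * hopfKernel ε (ε * t) s = hopfScaledDensity ε t s := by
  have hq : 2 * (1 - Real.cos (ε * t)) = ε ^ 2 * (t * Real.sinc (ε * t / 2)) ^ 2 := by
    rw [← mul_pow, mul_mul_sinc, mul_pow, Real.sin_sq_eq_half_sub,
      mul_div_cancel₀ _ (two_ne_zero' ℝ)]
    ring
  rw [hopfKernel, hopfScaledDensity, hopfDistSq, hq]
  generalize (t * Real.sinc (ε * t / 2)) ^ 2 = q at *
  have hD : ε ^ 2 + ε ^ 2 * q * (1 + ε * Real.cos s) = ε ^ 2 * (1 + q * (1 + ε * Real.cos s)) := by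
    ring
  have hc : Real.cos (ε * t) - 1 = -(ε ^ 2 * q / 2) := by linarith
  rw [hD, Real.sqrt_mul (by positivity), Real.sqrt_sq h0.le, mul_pow, hc, ← mul_div_assoc,
    ← mul_div_mul_left _ (Real.sqrt _ ^ 3) (pow_pos h0 3).ne']
  congr 1
  ring

theorem tendsto_hopfScaledDensity (t s : ℝ) :
    Tendsto (fun ε => hopfScaledDensity ε t s) (𝓝[>] 0) (𝓝 ((1 + t ^ 2) ^ (-(3 / 2) : ℝ))) := by
  have hs := Real.continuous_sinc
  have h : ContinuousAt (fun ε => hopfScaledDensity ε t s) 0 := by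
    refine ContinuousAt.div (by fun_prop) (by fun_prop) ?_
    simp only [zero_mul, zero_div, Real.sinc_zero, mul_one, add_zero]
    positivity
  have h' := h.tendsto.mono_left (nhdsWithin_le_nhds (s := Ioi 0))
  rw [one_add_sq_rpow_eq]
  simpa [hopfScaledDensity] using h'

/-- A bound that is uniform in small `ε`. The term of the numerator that is quadratic in
`q = t sinc (ε t / 2)` is only of order `|q|`, since `ε q = 2 sin (ε t / 2)`; and on the range of
`t` the Jordan inequality bounds `|q|` below by a multiple of `|t|`. -/
theorem abs_hopfScaledDensity_le {ε t : ℝ} (h0 : 0 < ε) (h1 : ε ≤ 1 / 2)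
    (ht : |t| ≤ Real.pi / ε) (s : ℝ) : |hopfScaledDensity ε t s| ≤ 10 * (1 + t ^ 2)⁻¹ := by
  have hq1 : |ε * (t * Real.sinc (ε * t / 2))| ≤ 2 := by
    rw [mul_mul_sinc, abs_mul, abs_two]
    linarith [Real.abs_sin_le_one (ε * t / 2)]
  have hq2 : t ^ 2 ≤ 5 / 2 * (t * Real.sinc (ε * t / 2)) ^ 2 := by
    have hx : |ε * t / 2| ≤ Real.pi / 2 := by
      rw [abs_div, abs_mul, abs_two, abs_of_pos h0]
      rw [le_div_iff₀ h0] at ht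
      linarith
    have hj := Real.mul_abs_le_abs_sin hx
    have hj2 : (2 / Real.pi * |ε * t / 2|) ^ 2 ≤ |Real.sin (ε * t / 2)| ^ 2 := by
      gcongr
    have hm := congrArg (· ^ 2) (mul_mul_sinc ε t)
    rw [mul_pow, sq_abs, sq_abs] at hj2
    simp only [mul_pow ε] at hm
    generalize t * Real.sinc (ε * t / 2) = q at *
    have hpi : Real.pi ^ 2 ≤ 10 := by nlinarith [Real.pi_lt_d2, Real.pi_pos]
    have hj3 : ε ^ 2 * t ^ 2 ≤ ε ^ 2 * (q ^ 2 * (Real.pi ^ 2 / 4)) := by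
      have h4 : (2 / Real.pi) ^ 2 * (ε * t / 2) ^ 2 = ε ^ 2 * t ^ 2 / Real.pi ^ 2 := by
        field_simp
      rw [h4, div_le_iff₀ (by positivity)] at hj2
      nlinarith
    have := le_of_mul_le_mul_left hj3 (by positivity)
    nlinarith [sq_nonneg q]
  rw [hopfScaledDensity]
  generalize t * Real.sinc (ε * t / 2) = q at *
  set E := 1 + q ^ 2 * (1 + ε * Real.cos s) with hE
  have hs := abs_le.1 (Real.abs_cos_le_one s)
  have hE1 : 1 + q ^ 2 / 2 ≤ E := by
    have : -(1 / 2) ≤ ε * Real.cos s := by nlinarith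
    nlinarith [sq_nonneg q]
  have hE0 : 0 < E := by nlinarith [sq_nonneg q]
  have hr := Real.sqrt_pos.2 hE0
  have hr2 := Real.sq_sqrt hE0.le
  have hnum : |Real.cos s * (-(ε / 2) * q ^ 2) + Real.cos (ε * t)| ≤ 2 * Real.sqrt E := by
    have e1 : |Real.cos s * (-(ε / 2) * q ^ 2)| ≤ |q| := by
      have : Real.cos s * (-(ε / 2) * q ^ 2) = -(Real.cos s * (ε * q) / 2 * q) := by ring
      rw [this, abs_neg, abs_mul, abs_div, abs_mul, abs_two]
      have : |Real.cos s| * |ε * q| ≤ 1 * 2 := by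
        gcongr
        exact Real.abs_cos_le_one s
      have := mul_le_mul_of_nonneg_right this (abs_nonneg q)
      linarith
    refine (abs_add_le _ _).trans ((add_le_add e1 (Real.abs_cos_le_one _)).trans ?_)
    refine abs_le_of_sq_le_sq' ?_ (by positivity) |>.2
    nlinarith [sq_abs q, sq_nonneg (|q| - 1)]
  rw [abs_div, abs_of_pos (pow_pos hr 3), div_le_iff₀ (pow_pos hr 3)]
  refine hnum.trans ?_
  have h3 : Real.sqrt E ^ 3 = E * Real.sqrt E := by rw [← hr2]; rw [Real.sqrt_sq hr.le]; ring
  rw [h3, ← mul_assoc]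
  refine mul_le_mul_of_nonneg_right ?_ hr.le
  rw [mul_right_comm, ← div_eq_mul_inv, le_div_iff₀ (by positivity)]
  nlinarith

theorem continuous_gaussLinkingDensity_hopf {ε : ℝ} (h0 : 0 < ε) (h2 : ε < 2) :
    Continuous fun p : ℝ × ℝ => gaussLinkingDensity (hopfC ε) (hopfC' ε) p.1 p.2 := by
  simp only [gaussLinkingDensity_hopf]
  exact continuous_const.mul ((continuous_hopfKernel h0 h2).comp
    (by fun_prop : Continuous fun p : ℝ × ℝ => (ε * p.1, p.2)))

theorem integrableOn_gaussLinkingDensity_hopf {ε : ℝ} (h0 : 0 < ε) (h2 : ε < 2) :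
    IntegrableOn (fun p : ℝ × ℝ => gaussLinkingDensity (hopfC ε) (hopfC' ε) p.1 p.2)
      (Icc (-(Real.pi / ε)) (Real.pi / ε) ×ˢ Icc (-Real.pi) Real.pi) :=
  (continuous_gaussLinkingDensity_hopf h0 h2).continuousOn.integrableOn_compact
    (isCompact_Icc.prod isCompact_Icc)

theorem hopfLink_eq_setIntegral_density {ε : ℝ} (h0 : 0 < ε) (h2 : ε < 2) :
    hopfLink ε = 1 / (4 * Real.pi) *
      ∫ p in Icc (-(Real.pi / ε)) (Real.pi / ε) ×ˢ Icc (-Real.pi) Real.pi,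
        gaussLinkingDensity (hopfC ε) (hopfC' ε) p.1 p.2 := by
  have hpi := Real.pi_pos
  have hpe : 0 < Real.pi / ε := by positivity
  have hi := integrableOn_gaussLinkingDensity_hopf h0 h2
  rw [Measure.volume_eq_prod] at hi ⊢
  rw [setIntegral_prod _ hi, hopfLink, gaussLinkingIntegral,
    intervalIntegral.integral_of_le (by linarith), ← integral_Icc_eq_integral_Ioc]
  simp only [intervalIntegral.integral_of_le (by linarith : -Real.pi ≤ Real.pi),
    ← integral_Icc_eq_integral_Ioc]

theorem hopfLink_eq_setIntegral_kernel {ε : ℝ} (h0 : 0 < ε) (h2 : ε < 2) :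
    hopfLink ε = 1 / (4 * Real.pi) *
      ∫ p in Icc (-Real.pi) Real.pi ×ˢ Icc (-Real.pi) Real.pi, hopfKernel ε p.1 p.2 := by
  have hpi := Real.pi_pos
  have hi := (continuous_hopfKernel h0 h2).continuousOn.integrableOn_compact (μ := volume)
    ((isCompact_Icc (a := -Real.pi) (b := Real.pi)).prod
      (isCompact_Icc (a := -Real.pi) (b := Real.pi)))
  rw [Measure.volume_eq_prod] at hi ⊢
  rw [setIntegral_prod _ hi, hopfLink, gaussLinkingIntegral]
  simp only [gaussLinkingDensity_hopf, intervalIntegral.integral_const_mul]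
  rw [intervalIntegral.mul_integral_comp_mul_left
    (f := fun u => ∫ s in (-Real.pi)..Real.pi, hopfKernel ε u s),
    mul_neg, mul_div_cancel₀ _ h0.ne']
  simp only [intervalIntegral.integral_of_le (by linarith : -Real.pi ≤ Real.pi),
    ← integral_Icc_eq_integral_Ioc]

/-- In the parameter `t` the domains `[-π/ε, π/ε]` exhaust `ℝ`, and the bound
`abs_hopfScaledDensity_le` allows the passage to the limit under the integral. -/
theorem tendsto_hopfLink : Tendsto hopfLink (𝓝[>] 0) (𝓝 1) := by
  have hpi := Real.pi_pos
  have hlim : Tendsto (fun ε : ℝ => ∫ p in univ ×ˢ Icc (-Real.pi) Real.pi,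
      (Icc (-(Real.pi / ε)) (Real.pi / ε) ×ˢ univ).indicator
        (fun p : ℝ × ℝ => gaussLinkingDensity (hopfC ε) (hopfC' ε) p.1 p.2) p) (𝓝[>] 0)
      (𝓝 (∫ p in (univ : Set ℝ) ×ˢ Icc (-Real.pi) Real.pi,
        (1 + p.1 ^ 2) ^ (-(3 / 2) : ℝ))) := by
    refine tendsto_integral_filter_of_dominated_convergence
      (fun p => 10 * (1 + p.1 ^ 2)⁻¹) ?_ ?_ ?_ ?_
    · filter_upwards [Ioo_mem_nhdsGT (two_pos : (0 : ℝ) < 2)] with ε hε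
      exact (continuous_gaussLinkingDensity_hopf hε.1 hε.2).aestronglyMeasurable.indicator
        (measurableSet_Icc.prod MeasurableSet.univ)
    · filter_upwards [Ioo_mem_nhdsGT (by norm_num : (0 : ℝ) < 1 / 2)] with ε hε
      refine Eventually.of_forall fun p => ?_
      by_cases hp : p ∈ Icc (-(Real.pi / ε)) (Real.pi / ε) ×ˢ (univ : Set ℝ)
      · rw [indicator_of_mem hp, gaussLinkingDensity_hopf, mul_hopfKernel_eq hε.1]
        exact abs_hopfScaledDensity_le hε.1 hε.2.le (abs_le.2 hp.1) _
      · rw [indicator_of_notMem hp, norm_zero]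
        positivity
    · rw [Measure.volume_eq_prod, ← Measure.prod_restrict, Measure.restrict_univ]
      exact (integrable_inv_one_add_sq.const_mul 10).comp_fst _
    · refine Eventually.of_forall fun p => (tendsto_hopfScaledDensity p.1 p.2).congr' ?_
      have hm : ∀ᶠ ε : ℝ in 𝓝[>] 0, |p.1| < Real.pi / ε :=
        (tendsto_inv_nhdsGT_zero.const_mul_atTop hpi).eventually_gt_atTop |p.1|
      filter_upwards [hm, self_mem_nhdsWithin] with ε hε h0
      have hp : p ∈ Icc (-(Real.pi / ε)) (Real.pi / ε) ×ˢ (univ : Set ℝ) :=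
        ⟨abs_le.1 hε.le, mem_univ _⟩
      rw [indicator_of_mem hp, gaussLinkingDensity_hopf,
        mul_hopfKernel_eq h0]
  have hval : ∫ p in (univ : Set ℝ) ×ˢ Icc (-Real.pi) Real.pi,
      (1 + p.1 ^ 2) ^ (-(3 / 2) : ℝ) = 4 * Real.pi := by
    have hi := integrableOn_one_add_sq_rpow
    rw [Measure.volume_eq_prod] at hi ⊢
    rw [setIntegral_prod _ hi, setIntegral_univ, ← integral_integral_one_add_sq_rpow]
    simp only [intervalIntegral.integral_of_le (by linarith : -Real.pi ≤ Real.pi),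
      ← integral_Icc_eq_integral_Ioc]
  rw [hval] at hlim
  have h1 := hlim.const_mul (1 / (4 * Real.pi))
  rw [one_div_mul_cancel (by positivity)] at h1
  refine h1.congr' ?_
  filter_upwards [Ioo_mem_nhdsGT (two_pos : (0 : ℝ) < 2)] with ε hε
  rw [hopfLink_eq_setIntegral_density hε.1 hε.2,
    setIntegral_indicator (measurableSet_Icc.prod MeasurableSet.univ), prod_inter_prod,
    univ_inter, inter_univ]

theorem hopfLink_eq_one {ε : ℝ} (h0 : 0 < ε) (h2 : ε < 2) : hopfLink ε = 1 := by
  refine tendsto_nhds_unique (tendsto_const_nhds.congr' ?_) tendsto_hopfLink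
  filter_upwards [Ioo_mem_nhdsGT (two_pos : (0 : ℝ) < 2)] with δ hδ
  rw [hopfLink_eq_setIntegral_kernel h0 h2, hopfLink_eq_setIntegral_kernel hδ.1 hδ.2,
    integral_hopfKernel_eq ⟨h0, h2⟩ hδ]

theorem mainTheorem2 :
    (∀ ε : ℝ, 0 < ε → ε < 2 →
      Disjoint (hopfC ε '' Icc (-(Real.pi / ε)) (Real.pi / ε))
        (hopfC' ε '' Icc (-Real.pi) Real.pi) ∧
      (∀ t s : ℝ, gaussLinkingDensity (hopfC ε) (hopfC' ε) t s =
        ε ^ 2 * (Real.cos s * (Real.cos (ε * t) - 1) + ε * Real.cos (ε * t)) /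
          Real.sqrt (2 + ε ^ 2 - 2 * Real.cos (ε * t)
            + 4 * ε * Real.cos s * Real.sin (ε * t / 2) ^ 2) ^ 3) ∧
      IntegrableOn (fun p : ℝ × ℝ => gaussLinkingDensity (hopfC ε) (hopfC' ε) p.1 p.2)
        (Icc (-(Real.pi / ε)) (Real.pi / ε) ×ˢ Icc (-Real.pi) Real.pi) ∧
      hopfLink ε = 1) ∧
    (∀ t s : ℝ, Tendsto (fun ε : ℝ => gaussLinkingDensity (hopfC ε) (hopfC' ε) t s)
      (𝓝[>] 0) (𝓝 ((1 + t ^ 2) ^ (-(3 / 2) : ℝ)))) ∧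
    Tendsto hopfLink (𝓝[>] 0)
      (𝓝 (1 / (4 * Real.pi) *
        ∫ t : ℝ, ∫ _s in (-Real.pi)..Real.pi, (1 + t ^ 2) ^ (-(3 / 2) : ℝ))) ∧
    IntegrableOn (fun p : ℝ × ℝ => (1 + p.1 ^ 2) ^ (-(3 / 2) : ℝ))
      (univ ×ˢ Icc (-Real.pi) Real.pi) ∧
    1 / (4 * Real.pi) *
      (∫ t : ℝ, ∫ _s in (-Real.pi)..Real.pi, (1 + t ^ 2) ^ (-(3 / 2) : ℝ)) = 1 := by
  refine ⟨fun ε h0 h2 => ⟨?_, fun t s => ?_, integrableOn_gaussLinkingDensity_hopf h0 h2,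
    hopfLink_eq_one h0 h2⟩, fun t s => ?_, ?_, integrableOn_one_add_sq_rpow, ?_⟩
  · rw [Set.disjoint_left]
    rintro _ ⟨t, -, rfl⟩ ⟨s, -, h⟩
    exact hopfC_ne_hopfC' h0 h2 t s h.symm
  · rw [gaussLinkingDensity_hopf, hopfKernel, hopfDistSq_eq]
    ring
  · refine (tendsto_hopfScaledDensity t s).congr' ?_
    filter_upwards [self_mem_nhdsWithin] with ε h0
    rw [gaussLinkingDensity_hopf, mul_hopfKernel_eq h0]
  · rw [integral_integral_one_add_sq_rpow, one_div_mul_cancel (by positivity)]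
    exact tendsto_hopfLink
  · rw [integral_integral_one_add_sq_rpow, one_div_mul_cancel (by positivity)]
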